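/- Let $r\in\mathbb N_0$, let $D\subset\mathbb R$ be open, let $f:D\to\mathbb R$ be $(r+1)$-times continuously differentiable, and let $y:[0,T]\to D$ solve $\dot y(t)=f(y(t))$ on $0\le t\le T$, $y(0)=y_0\in D$. For each $\eta\in D$ let $h\mapsto w(h,\eta)$ be the maximally extended solution of $$\frac{\partial w}{\partial h}(h,\eta)=\sum_{j=0}^{r}\frac{f^{(j)}(\eta)}{j!}\,w(h,\eta)^j,\qquad w(0,\eta)=0,$$ let $U_{\max}\subset\mathbb R\times D$ be the set of all $(h,\eta)$ such that $h$ belongs to the (open) maximal existence interval of $w(\cdot,\eta)$, and define $\Phi:U_{\max}\to\mathbb R$ by $\Phi(h,\eta)=\eta+w(h,\eta)$. (a) For every compact set $K\subset D$ whose interior contains $y([0,T])$ there exist $h_0>0$ with $[0,h_0]\times K\subset U_{\max}$, so that $\Phi$ is defined on $[0,h_0]\times K$, and a constant $C\ge 0$, independent of $h$ and $t$, such that $$\bigl|y(t+h)-\Phi(h,y(t))\bigr|\le C\,h^{r+2}$$ for all $0\le h\le h_0$ and $0\le t\le T$ with $t+h\le T$. (b) If $f$ is (the restriction to $D$ of)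 a polynomial of degree $\le r$, then for all $t,h\ge 0$ with $t+h\le T$ one has $(h,y(t))\in U_{\max}$ and $y(t+h)=\Phi(h,y(t))$, i.e. the method is locally exact. -/

import Mathlib

open Set

namespace TaylorMethod

/-- The Taylor right-hand side `F(w, y) = ∑_{j ≤ r} f^{(j)}(y) / j! * w ^ j`.
It is only used at points `y` of the open set on which `f` is given and smooth. -/
noncomputable def taylorF (r : ℕ) (f : ℝ → ℝ) (w y : ℝ) : ℝ :=
  ∑ j ∈ Finset.range (r + 1), iteratedDeriv j f y / (j.factorial : ℝ) * w ^ j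

/-- `u` solves `u' = F(u, y)`, `u(0) = 0` on the open interval `(a, b)`, which contains `0`. -/
structure IsSolOn (r : ℕ) (f : ℝ → ℝ) (y a b : ℝ) (u : ℝ → ℝ) : Prop where
  left_neg : a < 0
  right_pos : 0 < b
  init : u 0 = 0
  deriv : ∀ h ∈ Ioo a b, HasDerivAt u (taylorF r f (u h) y) h

/-- The maximal existence interval of `w' = F(w, y)`, `w(0) = 0`: the union of all open intervals
around `0` on which this initial value problem has a solution. -/
def maxInterval (r : ℕ) (f : ℝ → ℝ) (y : ℝ) : Set ℝ :=
  {h | ∃ a b : ℝ, ∃ u : ℝ → ℝ, IsSolOn r f y a b u ∧ h ∈ Ioo a b}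

/-- `U_max`: the pairs `(h, y)`, `y ∈ D`, such that `h` lies in the maximal existence interval
for the parameter `y`. -/
def Umax (r : ℕ) (f : ℝ → ℝ) (D : Set ℝ) : Set (ℝ × ℝ) :=
  {q | q.2 ∈ D ∧ q.1 ∈ maxInterval r f q.2}

open Classical in
/-- The maximally extended solution `w(h, y)`: on the maximal interval, the value at `h` of any
solution that reaches `h` (see `w_eq_of_isSolOn`); the value `0` elsewhere is irrelevant. -/
noncomputable def w (r : ℕ) (f : ℝ → ℝ) (h y : ℝ) : ℝ :=
  if hh : h ∈ maxInterval r f y then hh.choose_spec.choose_spec.choose h else 0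

/-- The one-step method `Φ(h, y) = y + w(h, y)`, meaningful for `(h, y) ∈ U_max`. -/
noncomputable def Phi (r : ℕ) (f : ℝ → ℝ) (h y : ℝ) : ℝ := y + w r f h y

/-- Two solutions agree wherever both are defined. -/
theorem IsSolOn.eq {r : ℕ} {f : ℝ → ℝ} {y a b a' b' : ℝ} {u v : ℝ → ℝ}
    (hu : IsSolOn r f y a b u) (hv : IsSolOn r f y a' b' v) {h : ℝ}
    (h1 : h ∈ Ioo a b) (h2 : h ∈ Ioo a' b') : u h = v h := by
  obtain ⟨c, hc1, hc2⟩ := exists_between (show max a a' < min 0 h from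
    max_lt (lt_min hu.left_neg h1.1) (lt_min hv.left_neg h2.1))
  obtain ⟨d, hd1, hd2⟩ := exists_between (show max 0 h < min b b' from
    max_lt (lt_min hu.right_pos hv.right_pos) (lt_min h1.2 h2.2))
  have mu : Icc c d ⊆ Ioo a b := fun x hx =>
    ⟨(max_lt_iff.1 hc1).1.trans_le hx.1, hx.2.trans_lt (lt_min_iff.1 hd2).1⟩
  have mv : Icc c d ⊆ Ioo a' b' := fun x hx =>
    ⟨(max_lt_iff.1 hc1).2.trans_le hx.1, hx.2.trans_lt (lt_min_iff.1 hd2).2⟩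
  have cu : ContinuousOn u (Icc c d) := fun x hx =>
    (hu.deriv x (mu hx)).continuousAt.continuousWithinAt
  have cv : ContinuousOn v (Icc c d) := fun x hx =>
    (hv.deriv x (mv hx)).continuousAt.continuousWithinAt
  obtain ⟨R1, hR1⟩ := isCompact_Icc.exists_bound_of_continuousOn cu
  obtain ⟨R2, hR2⟩ := isCompact_Icc.exists_bound_of_continuousOn cv
  have hF : ContDiff ℝ 1 (fun x => taylorF r f x y) := by
    unfold taylorF
    fun_prop
  obtain ⟨L, hL⟩ := hF.contDiffOn.exists_lipschitzOnWith (s := Metric.closedBall 0 (max R1 R2))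
    one_ne_zero (convex_closedBall _ _) (isCompact_closedBall _ _)
  refine ODE_solution_unique_of_mem_Icc (v := fun _ x => taylorF r f x y)
    (s := fun _ => Metric.closedBall 0 (max R1 R2)) (t₀ := 0) (K := L) (fun t _ => hL)
    ⟨(lt_min_iff.1 hc2).1, (max_lt_iff.1 hd1).1⟩
    cu (fun t ht => hu.deriv t (mu (Ioo_subset_Icc_self ht)))
    (fun t ht => ?_)
    cv (fun t ht => hv.deriv t (mv (Ioo_subset_Icc_self ht)))
    (fun t ht => ?_) (hu.init.trans hv.init.symm)
    ⟨(lt_min_iff.1 hc2).2.le, (max_lt_iff.1 hd1).2.le⟩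
  · simpa using Or.inl (hR1 t (Ioo_subset_Icc_self ht))
  · simpa using Or.inr (hR2 t (Ioo_subset_Icc_self ht))

/-- `w(·, y)` extends every solution of the initial value problem. -/
theorem w_eq_of_isSolOn {r : ℕ} {f : ℝ → ℝ} {y a b : ℝ} {u : ℝ → ℝ}
    (hu : IsSolOn r f y a b u) {h : ℝ} (hh : h ∈ Ioo a b) : w r f h y = u h := by
  have hm : h ∈ maxInterval r f y := ⟨a, b, u, hu, hh⟩
  rw [w, dif_pos hm]
  have := hm.choose_spec.choose_spec.choose_spec
  exact this.1.eq hu this.2 hh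

/-- `w(·, y)` solves the differential equation on its maximal interval. -/
theorem hasDerivAt_w {r : ℕ} {f : ℝ → ℝ} {y h : ℝ} (hh : h ∈ maxInterval r f y) :
    HasDerivAt (fun s => w r f s y) (taylorF r f (w r f h y) y) h := by
  obtain ⟨a, b, u, hu, hab⟩ := hh
  rw [w_eq_of_isSolOn hu hab]
  refine (hu.deriv h hab).congr_of_eventuallyEq ?_
  filter_upwards [isOpen_Ioo.mem_nhds hab] with s hs using w_eq_of_isSolOn hu hs

end TaylorMethod

/-!
Fix `t` and put `η = y t`. The increment `v s = y (t + s) - η` vanishes at `s = 0` and satisfies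
`v' = f (η + v)`, while `w(·, η)` solves the equation `w' = F(w, η)` whose right-hand side is the
Taylor polynomial of degree `r` of `f` at `η`.

For part (a), `F(·, η)` is bounded and Lipschitz on balls, uniformly for `η` in the compact set `K`
(`exists_bound_taylorF`, `exists_lipschitzOnWith_taylorF`), so Picard-Lindelöf gives a common
existence time for all `η ∈ K`, with `|w| ≤ 1` on it (`exists_solution_mem_closedBall`). Since
`|v s| ≤ B s`, the Taylor remainder (`abs_sub_taylorF_le`) shows that `v` solves the equation of `w`
up to a defect of size `O(s ^ (r + 1))`, uniformly in `t`, and Grönwall's inequality turns this into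
`|v h - w(h, η)| = O(h ^ (r + 2))`.

For part (b), `F(x, η) = f (η + x)` when `η` and `η + x` lie in `D` (`taylorF_eq_of_polynomial`), so
`v` itself solves the equation of `w` on the closed interval `[-t, T - t]`; it extends to a solution
on an open interval (`exists_extend_Ioo`) and agrees with `w` by uniqueness.
-/

namespace TaylorMethod

/-! ### Regularity of the Taylor right-hand side -/

theorem continuousOn_iteratedDeriv_of_isOpen {D : Set ℝ} (hD : IsOpen D) {f : ℝ → ℝ} {n : ℕ}
    (hf : ContDiffOn ℝ n f D) {j : ℕ} (hj : j ≤ n) :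
    ContinuousOn (iteratedDeriv j f) D :=
  (hf.continuousOn_iteratedDerivWithin (by exact_mod_cast hj) hD.uniqueDiffOn).congr
    fun _ hx => (iteratedDerivWithin_of_isOpen hD hx).symm

theorem taylorF_zero_left (r : ℕ) (f : ℝ → ℝ) (η : ℝ) : taylorF r f 0 η = f η := by
  simp [taylorF, Finset.sum_range_succ']

theorem contDiff_taylorF (r : ℕ) (f : ℝ → ℝ) (η : ℝ) :
    ContDiff ℝ 1 (fun x => taylorF r f x η) := by
  unfold taylorF
  fun_prop

/-- On a compact set of parameters `η`, the right-hand side `F(·, η)` is bounded on every ball. -/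
theorem exists_bound_taylorF {r : ℕ} {f : ℝ → ℝ} {D K : Set ℝ} (hD : IsOpen D)
    (hf : ContDiffOn ℝ r f D) (hK : IsCompact K) (hKD : K ⊆ D) (R : ℝ) :
    ∃ M : ℝ, 0 < M ∧ ∀ η ∈ K, ∀ x ∈ Metric.closedBall (0 : ℝ) R, ‖taylorF r f x η‖ ≤ M := by
  have hc : ContinuousOn (fun q : ℝ × ℝ => taylorF r f q.1 q.2)
      (Metric.closedBall (0 : ℝ) R ×ˢ K) := by
    unfold taylorF
    refine continuousOn_finsetSum _ fun j hj => ?_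
    have hj' : j ≤ r := Nat.lt_succ_iff.1 (Finset.mem_range.1 hj)
    have h1 := ((continuousOn_iteratedDeriv_of_isOpen hD hf hj').mono hKD).comp
      (t := K) (s := Metric.closedBall (0 : ℝ) R ×ˢ K) continuousOn_snd fun q hq => hq.2
    exact (h1.div_const _).mul (continuousOn_fst.pow _)
  obtain ⟨M, hM⟩ := ((isCompact_closedBall (0 : ℝ) R).prod hK).exists_bound_of_continuousOn hc
  exact ⟨max M 1, by positivity, fun η hη x hx => (hM (x, η) ⟨hx, hη⟩).trans (le_max_left _ _)⟩

/-- On a compact set of parameters `η`, the right-hand side `F(·, η)` is Lipschitz on every ball,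
with a constant that does not depend on `η`. -/
theorem exists_lipschitzOnWith_taylorF {r : ℕ} {f : ℝ → ℝ} {D K : Set ℝ} (hD : IsOpen D)
    (hf : ContDiffOn ℝ r f D) (hK : IsCompact K) (hKD : K ⊆ D) (R : ℝ) :
    ∃ L : NNReal, ∀ η ∈ K,
      LipschitzOnWith L (fun x => taylorF r f x η) (Metric.closedBall (0 : ℝ) R) := by
  have hc : ContinuousOn (fun q : ℝ × ℝ => ∑ j ∈ Finset.range (r + 1),
      iteratedDeriv j f q.2 / (j.factorial : ℝ) * (j * q.1 ^ (j - 1)))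
      (Metric.closedBall (0 : ℝ) R ×ˢ K) := by
    refine continuousOn_finsetSum _ fun j hj => ?_
    have hj' : j ≤ r := Nat.lt_succ_iff.1 (Finset.mem_range.1 hj)
    have h1 := ((continuousOn_iteratedDeriv_of_isOpen hD hf hj').mono hKD).comp
      (t := K) (s := Metric.closedBall (0 : ℝ) R ×ˢ K) continuousOn_snd fun q hq => hq.2
    exact (h1.div_const _).mul (continuousOn_const.mul (continuousOn_fst.pow _))
  obtain ⟨L, hL⟩ := ((isCompact_closedBall (0 : ℝ) R).prod hK).exists_bound_of_continuousOn hc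
  refine ⟨L.toNNReal, fun η hη => ?_⟩
  refine (convex_closedBall (0 : ℝ) R).lipschitzOnWith_of_nnnorm_hasDerivWithin_le
    (f' := fun x => ∑ j ∈ Finset.range (r + 1),
      iteratedDeriv j f η / (j.factorial : ℝ) * (j * x ^ (j - 1))) (fun x _ => ?_) (fun x hx => ?_)
  · unfold taylorF
    exact (HasDerivAt.fun_sum fun j _ => (hasDerivAt_pow j x).const_mul _).hasDerivWithinAt
  · rw [← NNReal.coe_le_coe, coe_nnnorm]
    exact (hL (x, η) ⟨hx, hη⟩).trans (Real.le_coe_toNNReal L)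

/-! ### Local existence and the Taylor remainder -/

/-- A Lipschitz autonomous vector field which is bounded by `M` on the ball of radius `R` has a
solution starting at the centre which stays in that ball for times `|t| ≤ R / M`. -/
theorem exists_solution_mem_closedBall {g : ℝ → ℝ} {M R ε : ℝ} {L : NNReal} (hR : 0 ≤ R)
    (hM : 0 ≤ M) (hε : 0 ≤ ε) (hMε : M * ε ≤ R)
    (hL : LipschitzOnWith L g (Metric.closedBall 0 R))
    (hb : ∀ x ∈ Metric.closedBall (0 : ℝ) R, ‖g x‖ ≤ M) :
    ∃ u : ℝ → ℝ, u 0 = 0 ∧ (∀ t, u t ∈ Metric.closedBall (0 : ℝ) R) ∧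
      ∀ t ∈ Icc (-ε) ε, HasDerivWithinAt u (g (u t)) (Icc (-ε) ε) t := by
  lift R to NNReal using hR
  lift M to NNReal using hM
  have hP : IsPicardLindelof (fun _ => g) (tmin := -ε) (tmax := ε)
      ⟨0, by simpa using hε⟩ 0 R 0 M L :=
    IsPicardLindelof.of_time_independent hb hL (by simpa using hMε)
  obtain ⟨α, hα⟩ := ODE.FunSpace.exists_isFixedPt_next hP (Metric.mem_closedBall_self le_rfl)
  have hmem : ∀ t, α.compProj t ∈ Metric.closedBall (0 : ℝ) R := fun t =>
    α.compProj_mem_closedBall hP.mul_max_le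
  refine ⟨α.compProj, ?_, hmem, fun t ht => ?_⟩
  · have : α.compProj ((⟨0, by simpa using hε⟩ : Icc (-ε) ε) : ℝ) = 0 := by
      rw [ODE.FunSpace.compProj_val, ← hα, ODE.FunSpace.next_apply₀]
    exact this
  · refine (ODE.hasDerivWithinAt_picard_Icc (t₀ := 0) (by simpa using hε) hP.continuousOn_uncurry
      α.continuous_compProj.continuousOn (fun t _ => hmem t) 0 ht).congr_of_mem ?_ ht
    intro t' ht'
    nth_rw 1 [← hα]
    rw [ODE.FunSpace.compProj_of_mem ht', ODE.FunSpace.next_apply]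

/-- The Taylor remainder on a segment of `D`, with the expansion at either end of the segment. -/
theorem abs_sub_taylorF_le {r : ℕ} {f : ℝ → ℝ} {D : Set ℝ} (hD : IsOpen D)
    (hf : ContDiffOn ℝ ((r + 1 : ℕ) : WithTop ℕ∞) f D) {x η N : ℝ} (hseg : uIcc η x ⊆ D)
    (hN : ∀ z ∈ uIcc η x, ‖iteratedDeriv (r + 1) f z‖ ≤ N) :
    |f x - taylorF r f (x - η) η| ≤ N * |x - η| ^ (r + 1) := by
  rcases eq_or_ne η x with rfl | hne
  · simp [taylorF_zero_left]
  obtain ⟨z, hz, h⟩ := taylor_mean_remainder_lagrange_iteratedDeriv (n := r) hne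
    (by simpa using hf.mono hseg)
  have hu : UniqueDiffOn ℝ (uIcc η x) := uniqueDiffOn_uIcc hne
  have hT : taylorWithinEval f r (uIcc η x) η x = taylorF r f (x - η) η := by
    rw [taylor_within_apply, taylorF]
    refine Finset.sum_congr rfl fun j hj => ?_
    have hj' : j ≤ r + 1 := (Finset.mem_range.1 hj).le
    rw [iteratedDerivWithin_eq_iteratedDeriv hu
      ((hf.contDiffAt (hD.mem_nhds (hseg left_mem_uIcc))).of_le (by exact_mod_cast hj'))
      left_mem_uIcc, smul_eq_mul]
    ring
  rw [← hT, h, abs_div, abs_mul, abs_pow, Nat.abs_cast]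
  have hz' := hN z (Ioo_subset_Icc_self hz)
  rw [Real.norm_eq_abs] at hz'
  have h1 : (1 : ℝ) ≤ ((r + 1).factorial : ℝ) := by exact_mod_cast (r + 1).factorial_pos
  exact (div_le_self (by positivity) h1).trans (by gcongr)

/-- With zero initial error and defect `ε`, the Grönwall bound is linear in the time `x`, up to the
exponential factor: this is where the local error gains one order over the defect. -/
theorem gronwallBound_zero_le {K ε x : ℝ} (hK : 0 ≤ K) (hε : 0 ≤ ε) :
    gronwallBound 0 K ε x ≤ ε * x * Real.exp (K * x) := by
  rcases hK.eq_or_lt with rfl | hK'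
  · simp [gronwallBound_K0]
  · rw [gronwallBound_of_K_ne_0 hK'.ne']
    have h1 : Real.exp (K * x) - 1 ≤ K * x * Real.exp (K * x) := by
      have h2 := Real.add_one_le_exp (-(K * x))
      have h3 : Real.exp (-(K * x)) * Real.exp (K * x) = 1 := by
        rw [← Real.exp_add]; simp
      nlinarith [Real.exp_pos (K * x)]
    calc 0 * Real.exp (K * x) + ε / K * (Real.exp (K * x) - 1)
        ≤ ε / K * (K * x * Real.exp (K * x)) := by
          rw [zero_mul, zero_add]; gcongr
      _ = ε * x * Real.exp (K * x) := by field_simp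

theorem hasDerivWithinAt_shift_sub {y : ℝ → ℝ} {T t s y' : ℝ}
    (hy : HasDerivWithinAt y y' (Icc 0 T) (t + s)) :
    HasDerivWithinAt (fun s => y (t + s) - y t) y' (Icc (-t) (T - t)) s := by
  have h := HasDerivWithinAt.comp (h := fun s => t + s) (s := Icc (-t) (T - t)) s hy
    ((hasDerivWithinAt_id s _).const_add t)
    (fun x hx => ⟨by linarith [hx.1], by linarith [hx.2]⟩)
  simpa [Function.comp_def] using h.sub_const (y t)

/-! ### Extension of solutions beyond a closed interval -/

theorem exists_extend_right {g : ℝ → ℝ} (hg : ContDiff ℝ 1 g) {a b : ℝ} (hab : a ≤ b)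
    {u : ℝ → ℝ} (hu : ∀ s ∈ Icc a b, HasDerivWithinAt u (g (u s)) (Icc a b) s) :
    ∃ ε : ℝ, 0 < ε ∧ ∃ v : ℝ → ℝ, EqOn v u (Icc a b) ∧
      ∀ s ∈ Icc a (b + ε), HasDerivWithinAt v (g (v s)) (Icc a (b + ε)) s := by
  obtain ⟨α, hα0, δ, hδ, hα⟩ :=
    (hg.contDiffAt (x := u b)).exists_forall_mem_closedBall_exists_eq_forall_mem_Ioo_hasDerivAt₀ b
  set v : ℝ → ℝ := fun s => if s ≤ b then u s else α s with hv
  have hvu : EqOn v u (Icc a b) := fun s hs => by simp [hv, hs.2]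
  have hvα : EqOn v α (Icc b (b + δ / 2)) := fun s hs => by
    rcases hs.1.eq_or_lt with rfl | h
    · simp [hv, hα0]
    · simp [hv, h]
  refine ⟨δ / 2, by positivity, v, hvu, fun s _ => ?_⟩
  have h1 : HasDerivWithinAt v (g (v s)) (Icc a b) s := by
    by_cases hs : s ∈ Icc a b
    · rw [hvu hs]
      exact (hu s hs).congr_of_mem hvu hs
    · exact HasFDerivWithinAt.of_notMem_closure (by rwa [isClosed_Icc.closure_eq])
  have h2 : HasDerivWithinAt v (g (v s)) (Icc b (b + δ / 2)) s := by
    by_cases hs : s ∈ Icc b (b + δ / 2)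
    · rw [hvα hs]
      exact (hα s ⟨by linarith [hs.1], by linarith [hs.2]⟩).hasDerivWithinAt.congr_of_mem hvα hs
    · exact HasFDerivWithinAt.of_notMem_closure (by rwa [isClosed_Icc.closure_eq])
  have := h1.union h2
  rwa [Icc_union_Icc_eq_Icc hab (by linarith)] at this

theorem hasDerivWithinAt_reflect {g u : ℝ → ℝ} {a b : ℝ}
    (hu : ∀ s ∈ Icc a b, HasDerivWithinAt u (g (u s)) (Icc a b) s) :
    ∀ s ∈ Icc (-b) (-a), HasDerivWithinAt (fun s => u (-s)) (-g (u (-s))) (Icc (-b) (-a)) s := by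
  intro s hs
  have h := HasDerivWithinAt.comp (h := fun s => -s) (s := Icc (-b) (-a)) s
    (hu (-s) ⟨by linarith [hs.2], by linarith [hs.1]⟩) ((hasDerivWithinAt_id s _).neg)
    (fun x hx => ⟨by linarith [hx.2], by linarith [hx.1]⟩)
  simpa [Function.comp_def] using h

/-- A solution of an autonomous `C¹` equation on a closed interval (possibly a single point)
extends to an open interval that contains it. -/
theorem exists_extend_Ioo {g : ℝ → ℝ} (hg : ContDiff ℝ 1 g) {a b : ℝ} (hab : a ≤ b)
    {u : ℝ → ℝ} (hu : ∀ s ∈ Icc a b, HasDerivWithinAt u (g (u s)) (Icc a b) s) :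
    ∃ a' b' : ℝ, a' < a ∧ b < b' ∧ ∃ v : ℝ → ℝ, EqOn v u (Icc a b) ∧
      ∀ s ∈ Ioo a' b', HasDerivAt v (g (v s)) s := by
  obtain ⟨ε, hε, v, hvu, hv⟩ := exists_extend_right hg hab hu
  -- Extending to the left amounts to extending the time-reversed solution to the right.
  obtain ⟨δ, hδ, z, hzv, hz⟩ := exists_extend_right hg.neg (by linarith : -(b + ε) ≤ -a)
    (hasDerivWithinAt_reflect hv)
  refine ⟨a - δ, b + ε, by linarith, by linarith, fun s => z (-s), fun s hs => ?_, fun s hs => ?_⟩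
  · have := hzv (x := -s) ⟨by linarith [hs.2], by linarith [hs.1]⟩
    simpa [hvu hs] using this
  · have h := hasDerivWithinAt_reflect (g := fun x => -g x) hz s
      ⟨by linarith [hs.1], by linarith [hs.2]⟩
    have := h.hasDerivAt (Icc_mem_nhds (by linarith [hs.1]) (by linarith [hs.2]))
    simpa using this

theorem iteratedDeriv_polynomial_eval (p : Polynomial ℝ) (j : ℕ) :
    iteratedDeriv j (fun x => p.eval x) = fun x => (Polynomial.derivative^[j] p).eval x := by
  induction j with
  | zero => simp
  | succ j ih =>
    rw [iteratedDeriv_succ, ih]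
    ext x
    rw [Polynomial.deriv, Function.iterate_succ_apply']

/-- A polynomial of degree at most `r` coincides with its Taylor polynomial of degree `r`. -/
theorem taylorF_eq_of_polynomial {r : ℕ} {f : ℝ → ℝ} {D : Set ℝ} (hD : IsOpen D)
    {p : Polynomial ℝ} (hp : p.natDegree ≤ r) (hfp : ∀ x ∈ D, f x = p.eval x) {x η : ℝ}
    (hx : x ∈ D) (hη : η ∈ D) : taylorF r f (x - η) η = f x := by
  have he : f =ᶠ[nhds η] fun x => p.eval x := by
    filter_upwards [hD.mem_nhds hη] with z hz using hfp z hz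
  rw [hfp x hx, ← Polynomial.taylor_eval_sub η p x, Polynomial.eval_eq_sum_range'
    (n := r + 1) (by rw [Polynomial.natDegree_taylor]; omega), taylorF]
  refine Finset.sum_congr rfl fun j _ => ?_
  rw [he.iteratedDeriv_eq, iteratedDeriv_polynomial_eval, Polynomial.taylor_coeff,
    ← Polynomial.factorial_smul_hasseDeriv]
  have : (j.factorial : ℝ) ≠ 0 := by exact_mod_cast j.factorial_ne_zero
  simp [field]

/-! ### Consistency and local exactness -/

/-- The one-step method has local error of order `r + 2` along solutions. -/
theorem exists_localError_bound {r : ℕ} {D : Set ℝ} (hD : IsOpen D) {f : ℝ → ℝ}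
    (hf : ContDiffOn ℝ ((r + 1 : ℕ) : WithTop ℕ∞) f D) {T : ℝ} {y : ℝ → ℝ}
    (hy : ∀ t ∈ Icc 0 T, HasDerivWithinAt y (f (y t)) (Icc 0 T) t)
    {K : Set ℝ} (hK : IsCompact K) (hKD : K ⊆ D) (hyK : MapsTo y (Icc 0 T) K) :
    ∃ h₀ : ℝ, 0 < h₀ ∧ Icc 0 h₀ ×ˢ K ⊆ Umax r f D ∧
      ∃ C : ℝ, 0 ≤ C ∧ ∀ t h : ℝ, 0 ≤ t → 0 ≤ h → h ≤ h₀ → t + h ≤ T →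
        |y (t + h) - Phi r f h (y t)| ≤ C * h ^ (r + 2) := by
  have hfr : ContDiffOn ℝ r f D := hf.of_le (by exact_mod_cast r.le_succ)
  have hyc : ContinuousOn y (Icc 0 T) := fun t ht => (hy t ht).continuousWithinAt
  have hyD : MapsTo y (Icc 0 T) D := fun t ht => hKD (hyK ht)
  have hJ : IsCompact (y '' Icc 0 T) := isCompact_Icc.image_of_continuousOn hyc
  have hJD : y '' Icc 0 T ⊆ D := hyD.image_subset
  -- `y` takes its values in an interval, so Taylor expansions between them stay inside `D`.
  have hseg : ∀ s ∈ Icc 0 T, ∀ t ∈ Icc 0 T, uIcc (y s) (y t) ⊆ y '' Icc 0 T := fun s hs t ht =>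
    (isPreconnected_Icc.image _ hyc).ordConnected.uIcc_subset
      (mem_image_of_mem _ hs) (mem_image_of_mem _ ht)
  obtain ⟨N, hN⟩ := hJ.exists_bound_of_continuousOn
    ((continuousOn_iteratedDeriv_of_isOpen hD hf le_rfl).mono hJD)
  obtain ⟨Y, hY⟩ := isCompact_Icc.exists_bound_of_continuousOn hyc
  obtain ⟨B, hB⟩ := isCompact_Icc.exists_bound_of_continuousOn (hf.continuousOn.comp hyc hyD)
  have hlip : ∀ s ∈ Icc 0 T, ∀ t ∈ Icc 0 T, |y t - y s| ≤ B * |t - s| := fun s hs t ht =>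
    (convex_Icc 0 T).norm_image_sub_le_of_norm_hasDerivWithin_le hy hB hs ht
  obtain ⟨M, hM0, hM⟩ := exists_bound_taylorF hD hfr hK hKD 1
  obtain ⟨L, hL⟩ := exists_lipschitzOnWith_taylorF hD hfr hK hKD (max 1 (2 * Y))
  have hsol : ∀ η ∈ K, ∃ u : ℝ → ℝ, IsSolOn r f η (-(1 / M)) (1 / M) u ∧
      ∀ s, u s ∈ Metric.closedBall (0 : ℝ) 1 := by
    intro η hη
    obtain ⟨u, hu0, hu1, hu⟩ := exists_solution_mem_closedBall (ε := 1 / M) zero_le_one hM0.le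
      (by positivity) (by rw [mul_one_div_cancel hM0.ne'])
      ((hL η hη).mono (Metric.closedBall_subset_closedBall (le_max_left _ _))) (hM η hη)
    exact ⟨u, ⟨neg_lt_zero.2 (by positivity), by positivity, hu0, fun s hs =>
      (hu s (Ioo_subset_Icc_self hs)).hasDerivAt (Icc_mem_nhds hs.1 hs.2)⟩, hu1⟩
  have hlt : 1 / (2 * M) < 1 / M := by
    rw [div_lt_div_iff₀ (by positivity) hM0]; linarith
  have hmem : ∀ s, 0 ≤ s → s ≤ 1 / (2 * M) → s ∈ Ioo (-(1 / M)) (1 / M) := fun s hs hs' =>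
    ⟨(neg_lt_zero.2 (by positivity)).trans_le hs, hs'.trans_lt hlt⟩
  refine ⟨1 / (2 * M), by positivity, fun q hq => ?_, |N| * |B| ^ (r + 1) *
    Real.exp (L * (1 / (2 * M))), by positivity, fun t h ht hh hh0 hth => ?_⟩
  · obtain ⟨u, hu, -⟩ := hsol q.2 hq.2
    exact ⟨hKD hq.2, _, _, u, hu, hmem q.1 hq.1.1 hq.1.2⟩
  have htT : t ∈ Icc 0 T := ⟨ht, by linarith⟩
  obtain ⟨u, hu, hu1⟩ := hsol (y t) (hyK htT)
  rw [Phi, w_eq_of_isSolOn hu (hmem h hh hh0)]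
  have hsT : ∀ s ∈ Icc 0 h, t + s ∈ Icc 0 T := fun s hs =>
    ⟨by linarith [hs.1], by linarith [hs.2]⟩
  have hder : ∀ s ∈ Icc 0 h, HasDerivWithinAt (fun s => y (t + s) - y t) (f (y (t + s)))
      (Icc (-t) (T - t)) s := fun s hs => hasDerivWithinAt_shift_sub (hy _ (hsT s hs))
  have hdu : ∀ s ∈ Icc 0 h, HasDerivAt u (taylorF r f (u s) (y t)) s := fun s hs =>
    hu.deriv s (hmem s hs.1 (hs.2.trans hh0))
  have key := dist_le_of_approx_trajectories_ODE_of_mem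
    (v := fun _ x => taylorF r f x (y t)) (s := fun _ => Metric.closedBall 0 (max 1 (2 * Y)))
    (K := L) (f := fun s => y (t + s) - y t) (f' := fun s => f (y (t + s)))
    (g := u) (g' := fun s => taylorF r f (u s) (y t)) (a := 0) (b := h)
    (εf := |N| * |B| ^ (r + 1) * h ^ (r + 1)) (εg := 0) (δ := 0)
    (fun _ _ => hL (y t) (hyK htT))
    (fun s hs => (hder s hs).continuousWithinAt.mono
      (Icc_subset_Icc (by linarith) (by linarith)))
    (fun s hs => (hder s (Ico_subset_Icc_self hs)).mono_of_mem_nhdsWithin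
      (Filter.mem_of_superset (Icc_mem_nhdsGE (show s < T - t by linarith [hs.2]))
        (Icc_subset_Icc_left (by linarith [hs.1]))))
    (fun s hs => ?_)
    (fun s hs => ?_)
    (fun s hs => (hdu s hs).continuousAt.continuousWithinAt)
    (fun s hs => (hdu s (Ico_subset_Icc_self hs)).hasDerivWithinAt)
    (fun s _ => by simp)
    (fun s _ => Metric.closedBall_subset_closedBall (le_max_left _ _) (hu1 s))
    (by simp [hu.init]) h ⟨hh, le_rfl⟩
  · rw [Real.dist_eq, show y (t + h) - y t - u h = y (t + h) - (y t + u h) by ring, add_zero,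
      sub_zero] at key
    refine (key.trans (gronwallBound_zero_le L.coe_nonneg (by positivity))).trans ?_
    calc |N| * |B| ^ (r + 1) * h ^ (r + 1) * h * Real.exp (L * h)
        ≤ |N| * |B| ^ (r + 1) * h ^ (r + 1) * h * Real.exp (L * (1 / (2 * M))) := by gcongr
      _ = |N| * |B| ^ (r + 1) * Real.exp (L * (1 / (2 * M))) * h ^ (r + 2) := by ring
  · have hs' := Ico_subset_Icc_self hs
    have hsub := hseg t htT (t + s) (hsT s hs')
    rw [Real.dist_eq]
    refine (abs_sub_taylorF_le hD hf (hsub.trans hJD) fun z hz => hN z (hsub hz)).trans ?_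
    have h1 : |y (t + s) - y t| ≤ |B| * h := by
      refine (hlip t htT (t + s) (hsT s hs')).trans ?_
      rw [add_sub_cancel_left, abs_of_nonneg hs.1]
      exact mul_le_mul (le_abs_self B) hs.2.le hs.1 (abs_nonneg B)
    rw [mul_assoc, ← mul_pow]
    gcongr
    exact le_abs_self N
  · have h1 := hY t htT
    have h2 := hY (t + s) (hsT s (Ico_subset_Icc_self hs))
    rw [mem_closedBall_zero_iff]
    exact (norm_sub_le _ _).trans (by linarith [le_max_right 1 (2 * Y)])

/-- The method is locally exact for polynomials of degree at most `r`: the shifted solution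
`s ↦ y (t + s) - y t` then solves the Taylor equation. -/
theorem mem_Umax_and_eq_Phi_of_polynomial {r : ℕ} {D : Set ℝ} (hD : IsOpen D) {f : ℝ → ℝ}
    {T : ℝ} {y : ℝ → ℝ} (hyD : ∀ t ∈ Icc 0 T, y t ∈ D)
    (hy : ∀ t ∈ Icc 0 T, HasDerivWithinAt y (f (y t)) (Icc 0 T) t)
    {p : Polynomial ℝ} (hp : p.natDegree ≤ r) (hfp : ∀ x ∈ D, f x = p.eval x)
    {t h : ℝ} (ht : 0 ≤ t) (hh : 0 ≤ h) (hth : t + h ≤ T) :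
    (h, y t) ∈ Umax r f D ∧ y (t + h) = Phi r f h (y t) := by
  have htD : y t ∈ D := hyD t ⟨ht, by linarith⟩
  have hu : ∀ s ∈ Icc (-t) (T - t), HasDerivWithinAt (fun s => y (t + s) - y t)
      (taylorF r f (y (t + s) - y t) (y t)) (Icc (-t) (T - t)) s := by
    intro s hs
    have hts : t + s ∈ Icc 0 T := ⟨by linarith [hs.1], by linarith [hs.2]⟩
    rw [taylorF_eq_of_polynomial hD hp hfp (hyD _ hts) htD]
    exact hasDerivWithinAt_shift_sub (hy _ hts)
  -- Solutions in the sense of `IsSolOn` live on open intervals around `0` and `h`, but `t` and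
  -- `t + h` may be the end points `0` and `T`: hence the extension.
  obtain ⟨a, b, ha, hb, v, hvu, hv⟩ := exists_extend_Ioo (contDiff_taylorF r f (y t))
    (by linarith : -t ≤ T - t) hu
  have hsol : IsSolOn r f (y t) a b v :=
    ⟨by linarith, by linarith, by simpa using hvu (x := 0) ⟨by linarith, by linarith⟩, hv⟩
  have hmem : h ∈ Ioo a b := ⟨by linarith, by linarith⟩
  refine ⟨⟨htD, a, b, v, hsol, hmem⟩, ?_⟩
  rw [Phi, w_eq_of_isSolOn hsol hmem, hvu ⟨by linarith, by linarith⟩]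
  ring

end TaylorMethod

theorem proposition2p2 (r : ℕ) (D : Set ℝ) (hD : IsOpen D) (f : ℝ → ℝ)
    (hf : ContDiffOn ℝ ((r + 1 : ℕ) : WithTop ℕ∞) f D)
    (T : ℝ) (hT : 0 ≤ T) (y₀ : ℝ) (y : ℝ → ℝ)
    (hyD : ∀ t ∈ Set.Icc 0 T, y t ∈ D)
    (hy : ∀ t ∈ Set.Icc 0 T, HasDerivWithinAt y (f (y t)) (Set.Icc 0 T) t)
    (hy₀ : y 0 = y₀) :
    (∀ K : Set ℝ, IsCompact K → K ⊆ D → y '' Set.Icc 0 T ⊆ interior K →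
      ∃ h₀ : ℝ, 0 < h₀ ∧ Set.Icc 0 h₀ ×ˢ K ⊆ TaylorMethod.Umax r f D ∧
        ∃ C : ℝ, 0 ≤ C ∧ ∀ t h : ℝ, 0 ≤ t → 0 ≤ h → h ≤ h₀ → t + h ≤ T →
          |y (t + h) - TaylorMethod.Phi r f h (y t)| ≤ C * h ^ (r + 2)) ∧
    ((∃ p : Polynomial ℝ, p.natDegree ≤ r ∧ ∀ x ∈ D, f x = p.eval x) →
      ∀ t h : ℝ, 0 ≤ t → 0 ≤ h → t + h ≤ T →
        (h, y t) ∈ TaylorMethod.Umax r f D ∧ y (t + h) = TaylorMethod.Phi r f h (y t)) :=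
  ⟨fun _ hK hKD hyK => TaylorMethod.exists_localError_bound hD hf hy hK hKD
      (mapsTo_iff_image_subset.2 (hyK.trans interior_subset)),
    fun ⟨_, hp, hfp⟩ _ _ ht hh hth =>
      TaylorMethod.mem_Umax_and_eq_Phi_of_polynomial hD hyD hy hp hfp ht hh hth⟩
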